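/- Let $n\ge 0$ and $S=\mathbb{C}[x_0,\ldots,x_n]$. For a collection $\mathcal F$ of forms (homogeneous polynomials) in $S$, the simultaneous Waring rank $\mathrm{rk}_{\mathbb C}\,\mathcal F$ is the minimal integer $r$ such that there exist linear forms $L_1,\ldots,L_r\in S$ with the property that every $F\in\mathcal F$ can be written as $F=\sum_{j=1}^r\lambda_{F,j}\,L_j^{\deg F}$ with $\lambda_{F,j}\in\mathbb C$ (the forms in $\mathcal F$ may have different degrees). For a single form, $\mathrm{rk}_{\mathbb C}\,F=\mathrm{rk}_{\mathbb C}\{F\}$ is its Waring rank. Theorem. Let $M_1=x_0^c x_1^{a_1}\cdots x_n^{a_n}$ and $M_2=x_0^c x_1^{b_1}\cdots x_n^{b_n}$, where $c\ge 1$, and $c\le a_i$ and $c\le b_i$ for $i=1,\ldots,n$, and let $M_{12}=\gcd(M_1,M_2)$ be the greatest common divisor of $M_1$ and $M_2$ in $S$ (it is unique up to a nonzero constant factor). Suppose that, for each $i=1,\ldots,n$, $|a_i-b_i|=0$ or $|a_i-b_i|=1$ or $|a_i-b_i|\ge c+1$. Then the ranks below are finite and $$\mathrm{rk}_{\mathbb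 C}\{M_1,M_2\}=\mathrm{rk}_{\mathbb C}\,M_1+\mathrm{rk}_{\mathbb C}\,M_2-\mathrm{rk}_{\mathbb C}\,M_{12}.$$ -/

import Mathlib

/-- Over `ℂ`, in the variables `x₀, …, xₙ`, there are `r` linear forms `L₁, …, L_r` such that
every `F` in the collection is a linear combination of the powers `L_j ^ deg F`. The linear
forms are common to all members of the collection; the coefficients may depend on `F`. -/
def HasSimultaneousWaringDecomposition {n : ℕ}
    (𝓕 : Set (MvPolynomial (Fin (n + 1)) ℂ)) (r : ℕ) : Prop :=
  ∃ L : Fin r → MvPolynomial (Fin (n + 1)) ℂ, (∀ j, (L j).IsHomogeneous 1) ∧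
    ∀ F ∈ 𝓕, ∃ coeffs : Fin r → ℂ,
      F = ∑ j, MvPolynomial.C (coeffs j) * L j ^ F.totalDegree

/-- The simultaneous Waring rank over `ℂ` of a collection of forms: the least number of linear
forms in a simultaneous decomposition, and `⊤` when there is no such decomposition. -/
noncomputable def simultaneousWaringRank {n : ℕ}
    (𝓕 : Set (MvPolynomial (Fin (n + 1)) ℂ)) : ℕ∞ :=
  ⨅ (r : ℕ) (_ : HasSimultaneousWaringDecomposition 𝓕 r), (r : ℕ∞)

/-- The Waring rank over `ℂ` of a single form. -/
noncomputable def waringRank {n : ℕ} (F : MvPolynomial (Fin (n + 1)) ℂ) : ℕ∞ :=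
  simultaneousWaringRank {F}

/-- The monomial `x₀ ^ c * x₁ ^ a₁ * ⋯ * xₙ ^ aₙ`; the exponent `a i` with `i : Fin n` belongs to
the variable with index `i + 1`. -/
noncomputable def specialMonomial {n : ℕ} (c : ℕ) (a : Fin n → ℕ) :
    MvPolynomial (Fin (n + 1)) ℂ :=
  MvPolynomial.X 0 ^ c * ∏ i : Fin n, MvPolynomial.X i.succ ^ a i

/-- `D` is a greatest common divisor of `F` and `G` in the polynomial ring (such a `D` is unique
up to a nonzero constant factor). -/
def IsGreatestCommonDivisor {n : ℕ} (F G D : MvPolynomial (Fin (n + 1)) ℂ) : Prop :=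
  D ∣ F ∧ D ∣ G ∧ ∀ E, E ∣ F → E ∣ G → E ∣ D

/-! Both ranks count the exponents in a down-set: a monomial has rank `∏ (a i + 1)`, the size of
`Finset.Iic a`, and the pair has rank `|Iic a ∪ Iic b|`. Since `Iic a ∩ Iic b = Iic (a ⊓ b)`, the
formula is inclusion-exclusion. Lower bound (`card_biUnion_Iic_le`): the monomials with exponents in
the down-set, dehomogenised at `x₀ = 1`, are linearly independent as functions on the linear forms
of any decomposition. Upper bound: a grid of forms `x₀ + ∑ zᵢ xᵢ` with `zᵢ ∈ Rᵢ`, `|Rᵢ| = aᵢ + 1`,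
decomposes a monomial once each `Rᵢ` carries suitable weights (`specialMonomial_eq_sum_pow`). The
condition on `|aᵢ - bᵢ|` lets the root sets for `aᵢ` and `bᵢ` be nested
(`exists_nested_momentWeights`), so the two grids overlap in exactly `∏ (min aᵢ bᵢ + 1)` points. -/

/-! ### Coefficients of powers of linear forms -/

open MvPolynomial in
theorem coeff_linearForm_pow {n : ℕ} (l : Fin (n + 1) → ℂ) (f : Fin (n + 1) → ℕ) (N : ℕ) :
    coeff (Finsupp.equivFunOnFinite.symm f) ((∑ i, l i • X i : MvPolynomial (Fin (n + 1)) ℂ) ^ N) =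
      if ∑ i, f i = N then
        ((Finsupp.equivFunOnFinite.symm f).multinomial : ℂ) * ∏ i, l i ^ f i else 0 := by
  rw [coeff_linearCombination_X_pow_of_fintype, Finsupp.sum_fintype _ _ (by simp),
    Finsupp.prod_fintype _ _ (by simp)]
  simp

open MvPolynomial in
theorem exists_eq_sum_smul_X {n : ℕ} {L : MvPolynomial (Fin (n + 1)) ℂ} (hL : L.IsHomogeneous 1) :
    ∃ l : Fin (n + 1) → ℂ, L = ∑ i, l i • X i := by
  rw [← mem_homogeneousSubmodule, homogeneousSubmodule_one_eq_span_X,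
    Submodule.mem_span_range_iff_exists_fun] at hL
  obtain ⟨l, hl⟩ := hL
  exact ⟨l, hl.symm⟩

theorem specialMonomial_eq_monomial {n : ℕ} (c : ℕ) (a : Fin n → ℕ) :
    specialMonomial c a =
      MvPolynomial.monomial (Finsupp.equivFunOnFinite.symm (Fin.cons c a)) 1 := by
  rw [MvPolynomial.monomial_eq, Finsupp.prod_fintype _ _ (by simp), Fin.prod_univ_succ]
  simp [specialMonomial]

theorem totalDegree_specialMonomial {n : ℕ} (c : ℕ) (a : Fin n → ℕ) :
    (specialMonomial c a).totalDegree = c + ∑ i, a i := by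
  rw [specialMonomial_eq_monomial, MvPolynomial.totalDegree_monomial _ one_ne_zero,
    Finsupp.sum_fintype _ _ (by simp), Fin.sum_univ_succ]
  simp

theorem multinomial_cast_ne_zero {σ : Type*} (f : σ →₀ ℕ) : (f.multinomial : ℂ) ≠ 0 := by
  rw [Finsupp.multinomial_eq]
  exact_mod_cast (Nat.multinomial_pos _ _).ne'

/-- Comparing coefficients and cancelling multinomials turns a decomposition into a functional on
forms of this degree that sees only the monomial itself. -/
theorem moments_of_eq_sum_pow {n c r : ℕ} {a : Fin n → ℕ} {l : Fin r → Fin (n + 1) → ℂ}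
    {w : Fin r → ℂ}
    (h : specialMonomial c a = ∑ j, MvPolynomial.C (w j) *
      (∑ i, l j i • MvPolynomial.X i) ^ (specialMonomial c a).totalDegree) :
    ∃ κ : ℂ, κ ≠ 0 ∧ ∀ f : Fin (n + 1) → ℕ, ∑ i, f i = c + ∑ i, a i →
      ∑ j, w j * ∏ i, l j i ^ f i = if f = Fin.cons c a then κ else 0 := by
  set M := (Finsupp.equivFunOnFinite.symm (Fin.cons c a : Fin (n + 1) → ℕ)).multinomial with hM
  refine ⟨(M : ℂ)⁻¹, inv_ne_zero (multinomial_cast_ne_zero _), fun f hf => ?_⟩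
  rw [totalDegree_specialMonomial, specialMonomial_eq_monomial] at h
  have := congrArg (MvPolynomial.coeff (Finsupp.equivFunOnFinite.symm f)) h
  simp only [MvPolynomial.coeff_monomial, MvPolynomial.coeff_sum, MvPolynomial.coeff_C_mul,
    coeff_linearForm_pow, hf, if_true] at this
  have hm := multinomial_cast_ne_zero (Finsupp.equivFunOnFinite.symm f)
  have h2 : ∑ j, w j * ((Finsupp.equivFunOnFinite.symm f).multinomial * ∏ i, l j i ^ f i) =
      ((Finsupp.equivFunOnFinite.symm f).multinomial : ℂ) * ∑ j, w j * ∏ i, l j i ^ f i := by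
    rw [Finset.mul_sum]
    exact Finset.sum_congr rfl fun j _ => by ring
  rw [h2] at this
  rw [← mul_right_inj' hm, ← this]
  by_cases hfa : f = Fin.cons c a
  · subst hfa
    rw [if_pos rfl, if_pos rfl, hM, mul_inv_cancel₀ hm]
  · rw [if_neg hfa, if_neg, mul_zero]
    simpa using fun h => hfa h.symm

/-! ### Lower bound -/

/-- The number of exponents below some exponent of the collection is a lower bound for the number
of linear forms in a simultaneous decomposition. -/
theorem card_biUnion_Iic_le {n c r : ℕ} (hc : 1 ≤ c) {𝓕 : Set (MvPolynomial (Fin (n + 1)) ℂ)}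
    {A : Finset (Fin n → ℕ)} (hA : ∀ a ∈ A, specialMonomial c a ∈ 𝓕)
    (h : HasSimultaneousWaringDecomposition 𝓕 r) : (A.biUnion Finset.Iic).card ≤ r := by
  obtain ⟨L, hL, h⟩ := h
  choose l hl using fun j => exists_eq_sum_smul_X (hL j)
  obtain rfl : L = fun j => ∑ i, l j i • MvPolynomial.X i := funext hl
  set v : (A.biUnion Finset.Iic) → Fin r → ℂ :=
    fun β j => ∏ i, (l j i.succ / l j 0) ^ β.1 i with hv
  suffices LinearIndependent ℂ v by
    simpa using this.fintype_card_le_finrank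
  rw [Fintype.linearIndependent_iff]
  intro g hg
  by_contra! hne
  -- Top total degree among the terms of the relation keeps the `x₀`-exponents below at least `c`.
  obtain ⟨β, hβ, hmax⟩ := Finset.exists_max_image (Finset.univ.filter fun β => g β ≠ 0)
    (fun β => ∑ i, β.1 i) (by obtain ⟨β, hβ⟩ := hne; exact ⟨β, by simpa using hβ⟩)
  replace hβ : g β ≠ 0 := by simpa using hβ
  replace hmax : ∀ γ, g γ ≠ 0 → ∑ i, γ.1 i ≤ ∑ i, β.1 i := fun γ hγ => hmax γ (by simpa using hγ)
  obtain ⟨a, haA, hβa⟩ := Finset.mem_biUnion.1 β.2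
  rw [Finset.mem_Iic] at hβa
  obtain ⟨w, hw⟩ := h _ (hA a haA)
  obtain ⟨κ, hκ, hmom⟩ := moments_of_eq_sum_pow hw
  set d := ∑ i, β.1 i with hd
  -- The relation times `x ^ (a - β)`, homogenised by `x₀` to degree `c + ∑ a i`; its `β` term
  -- becomes the monomial of `a`.
  let e : (A.biUnion Finset.Iic) → Fin (n + 1) → ℕ :=
    fun γ => Fin.cons (c + d - ∑ i, γ.1 i) fun i => a i - β.1 i + γ.1 i
  have hsum : ∀ γ, g γ ≠ 0 → ∑ i, e γ i = c + ∑ i, a i := by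
    intro γ hγ
    have h1 := hmax γ hγ
    have h2 : ∑ i, (a i - β.1 i) + d = ∑ i, a i := by
      rw [hd, ← Finset.sum_add_distrib]
      exact Finset.sum_congr rfl fun i _ => Nat.sub_add_cancel (hβa i)
    simp only [e, Fin.sum_univ_succ, Fin.cons_zero, Fin.cons_succ, Finset.sum_add_distrib]
    omega
  have hzero : ∀ j, ∑ γ, g γ * ∏ i, l j i ^ e γ i = 0 := by
    intro j
    -- Here `v` involves division by zero, but a positive power of `x₀` (as `c ≥ 1`) kills every
    -- term.
    by_cases hj : l j 0 = 0
    · refine Finset.sum_eq_zero fun γ _ => ?_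
      by_cases hγ : g γ = 0
      · rw [hγ, zero_mul]
      · have h1 := hmax γ hγ
        rw [Fin.prod_univ_succ]
        simp only [e, Fin.cons_zero, hj]
        rw [zero_pow (by omega), zero_mul, mul_zero]
    · have hgj : ∑ γ, g γ * v γ j = 0 := by simpa using congrFun hg j
      rw [← mul_zero (l j 0 ^ (c + d) * ∏ i : Fin n, l j i.succ ^ (a i - β.1 i)), ← hgj,
        Finset.mul_sum]
      refine Finset.sum_congr rfl fun γ _ => ?_
      by_cases hγ : g γ = 0
      · simp [hγ]
      · have h1 := hmax γ hγ
        have h2 : l j 0 ^ (c + d) = l j 0 ^ (c + d - ∑ i, γ.1 i) * ∏ i, l j 0 ^ γ.1 i := by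
          rw [Finset.prod_pow_eq_pow_sum, ← pow_add]
          congr 1
          omega
        have h3 : ∏ i, l j i.succ ^ γ.1 i = (∏ i, l j 0 ^ γ.1 i) * v γ j := by
          rw [hv, ← Finset.prod_mul_distrib]
          refine Finset.prod_congr rfl fun i _ => ?_
          rw [← mul_pow, mul_div_cancel₀ _ hj]
        simp only [Fin.prod_univ_succ, e, Fin.cons_zero, Fin.cons_succ, pow_add _ (a _ - β.1 _),
          Finset.prod_mul_distrib]
        rw [h2, h3]
        ring
  have heβ : e β = Fin.cons c a := by
    simp only [e]
    congr 1
    · omega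
    · exact funext fun i => Nat.sub_add_cancel (hβa i)
  have hinj : ∀ γ, e γ = Fin.cons c a → γ = β := by
    intro γ hγ
    refine Subtype.ext (funext fun i => ?_)
    have h1 : a i - β.1 i + γ.1 i = a i := congrFun hγ i.succ
    have h2 : β.1 i ≤ a i := hβa i
    omega
  have key : ∑ γ, g γ * ∑ j, w j * ∏ i, l j i ^ e γ i = 0 := by
    simp_rw [Finset.mul_sum]
    rw [Finset.sum_comm]
    refine Finset.sum_eq_zero fun j _ => ?_
    rw [← mul_zero (w j), ← hzero j, Finset.mul_sum]
    exact Finset.sum_congr rfl fun γ _ => by ring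
  rw [Finset.sum_eq_single β] at key
  · rw [hmom _ (hsum β hβ), if_pos heβ] at key
    exact mul_ne_zero hβ hκ key
  · intro γ _ hγβ
    by_cases hγ : g γ = 0
    · rw [hγ, zero_mul]
    · rw [hmom _ (hsum γ hγ), if_neg fun h => hγβ (hinj γ h), mul_zero]
  · simp

/-! ### One-variable weights on root sets -/

/-- Weights on the finite set `R` whose power moments of orders `≤ a + c` vanish, except the one of
order `a`, which is `1`. -/
def HasMomentWeights (c a : ℕ) (R : Finset ℂ) : Prop :=
  ∃ w : ℂ → ℂ, ∀ e ≤ a + c, ∑ z ∈ R, w z * z ^ e = if e = a then 1 else 0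

/-- The weights read off the degree `a` coefficient of the Lagrange interpolant. On `R`, `z ^ (a + 1
+ k)` agrees with `z ^ k * h`, of degree below `a` when `k < c`, so the higher moments vanish. -/
theorem hasMomentWeights_of_pow_eq_eval {c a : ℕ} {R : Finset ℂ} {h : Polynomial ℂ}
    (hcard : R.card = a + 1) (hdeg : h.natDegree + c ≤ a)
    (hR : ∀ z ∈ R, z ^ (a + 1) = h.eval z) : HasMomentWeights c a R := by
  have hw : ∀ p : Polynomial ℂ, p.natDegree ≤ a →
      ∑ z ∈ R, (Lagrange.basis R id z).coeff a * p.eval z = p.coeff a := by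
    intro p hp
    have h1 := Lagrange.eq_interpolate (s := R) (v := id) (f := p) (Set.injOn_id _) (by
      rw [hcard]
      exact (Polynomial.degree_le_of_natDegree_le hp).trans_lt (by exact_mod_cast Nat.lt_succ_self a))
    conv_rhs => rw [h1]
    rw [Lagrange.interpolate_apply, Polynomial.finsetSum_coeff]
    refine Finset.sum_congr rfl fun z _ => ?_
    rw [Polynomial.coeff_C_mul, mul_comm]
    rfl
  refine ⟨fun z => (Lagrange.basis R id z).coeff a, fun e he => ?_⟩
  by_cases hea : e ≤ a
  · have := hw (Polynomial.X ^ e) (by simpa using hea)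
    simp only [Polynomial.eval_pow, Polynomial.eval_X, Polynomial.coeff_X_pow] at this
    rw [this]
    simp [eq_comm]
  · obtain ⟨k, rfl⟩ := Nat.exists_eq_add_of_lt (not_le.1 hea)
    have hlt : (Polynomial.X ^ k * h).natDegree < a := by
      refine Polynomial.natDegree_mul_le.trans_lt ?_
      rw [Polynomial.natDegree_X_pow]
      omega
    rw [if_neg (by omega), ← Polynomial.coeff_eq_zero_of_natDegree_lt hlt, ← hw _ hlt.le]
    refine Finset.sum_congr rfl fun z hz => ?_
    rw [Polynomial.eval_mul, Polynomial.eval_pow, Polynomial.eval_X, ← hR z hz]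
    ring

theorem exists_finset_roots {m : ℕ} (hm : m ≠ 0) {q : ℂ} (hq : q ≠ 0) :
    ∃ R : Finset ℂ, R.card = m ∧ ∀ z, z ∈ R ↔ z ^ m = q := by
  have hζ := Complex.isPrimitiveRoot_exp m hm
  refine ⟨(Polynomial.nthRoots m q).toFinset, ?_, fun z => ?_⟩
  · rw [Multiset.toFinset_card_of_nodup (hζ.nthRoots_nodup hq), hζ.card_nthRoots,
      if_pos (IsAlgClosed.exists_pow_nat_eq q (Nat.pos_of_ne_zero hm))]
  · rw [Multiset.mem_toFinset, Polynomial.mem_nthRoots (Nat.pos_of_ne_zero hm)]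

/-- The roots of `z ^ (a + 1) - 1` are enlarged by the factor `z` if `b = a + 1`, and by `z ^ (b -
a) - 2` if `b ≥ a + c + 1`; both products have the gap below the leading term that the weights need.
-/
theorem exists_nested_momentWeights {c a b : ℕ} (ha : c ≤ a)
    (hab : b = a ∨ b = a + 1 ∨ a + c + 1 ≤ b) :
    ∃ R S : Finset ℂ, R ⊆ S ∧ R.card = a + 1 ∧ S.card = b + 1 ∧
      HasMomentWeights c a R ∧ HasMomentWeights c b S := by
  obtain ⟨R, hRc, hR⟩ := exists_finset_roots (Nat.succ_ne_zero a) (one_ne_zero (α := ℂ))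
  have hRw : HasMomentWeights c a R :=
    hasMomentWeights_of_pow_eq_eval (h := 1) hRc (by simpa using ha)
      fun z hz => by simpa using (hR z).1 hz
  rcases hab with rfl | rfl | hab
  · exact ⟨R, R, subset_rfl, hRc, hRc, hRw, hRw⟩
  · have h0 : (0 : ℂ) ∉ R := by simp [hR]
    have hc : (insert 0 R).card = a + 1 + 1 := by rw [Finset.card_insert_of_notMem h0, hRc]
    refine ⟨R, insert 0 R, Finset.subset_insert _ _, hRc, hc, hRw,
      hasMomentWeights_of_pow_eq_eval (h := Polynomial.X) hc (by simp; omega) fun z hz => ?_⟩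
    rw [Finset.mem_insert, hR] at hz
    rw [Polynomial.eval_X]
    rcases hz with rfl | hz
    · simp
    · rw [pow_succ, hz, one_mul]
  -- The constant `2` keeps the new roots off the unit circle, hence away from `R`.
  · obtain ⟨T, hTc, hT⟩ := exists_finset_roots (m := b - a) (by omega) (two_ne_zero (α := ℂ))
    have hdisj : Disjoint R T := by
      rw [Finset.disjoint_left]
      intro z hz hz'
      rw [hR] at hz
      rw [hT] at hz'
      have h1 := Complex.norm_eq_one_of_pow_eq_one hz (Nat.succ_ne_zero a)
      have h2 := congrArg norm hz'
      rw [norm_pow, h1, one_pow] at h2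
      norm_num at h2
    have hc : (R ∪ T).card = b + 1 := by rw [Finset.card_union_of_disjoint hdisj, hRc, hTc]; omega
    refine ⟨R, R ∪ T, Finset.subset_union_left, hRc, hc, hRw, hasMomentWeights_of_pow_eq_eval
      (h := Polynomial.C 2 * Polynomial.X ^ (a + 1) + Polynomial.X ^ (b - a) - Polynomial.C 2) hc
      ?_ fun z hz => ?_⟩
    · have : (Polynomial.C 2 * Polynomial.X ^ (a + 1) + Polynomial.X ^ (b - a) -
          Polynomial.C 2 : Polynomial ℂ).natDegree ≤ b - c := by
        refine (Polynomial.natDegree_sub_le _ _).trans (max_le ?_ (by simp))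
        refine (Polynomial.natDegree_add_le _ _).trans (max_le ?_ ?_)
        · exact (Polynomial.natDegree_C_mul_X_pow_le _ _).trans (by omega)
        · rw [Polynomial.natDegree_X_pow]
          omega
      omega
    · have hz' : (z ^ (a + 1) - 1) * (z ^ (b - a) - 2) = 0 := by
        rw [Finset.mem_union, hR, hT] at hz
        rcases hz with hz | hz <;> simp [hz]
      have hpow : z ^ (b + 1) = z ^ (a + 1) * z ^ (b - a) := by
        rw [← pow_add]
        congr 1
        omega
      simp only [Polynomial.eval_sub, Polynomial.eval_add, Polynomial.eval_mul, Polynomial.eval_C,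
        Polynomial.eval_pow, Polynomial.eval_X]
      rw [hpow]
      linear_combination hz'

theorem exists_momentWeights_pair {c a b : ℕ} (ha : c ≤ a) (hb : c ≤ b)
    (hab : |(a : ℤ) - (b : ℤ)| = 0 ∨ |(a : ℤ) - (b : ℤ)| = 1 ∨
      (c : ℤ) + 1 ≤ |(a : ℤ) - (b : ℤ)|) :
    ∃ R S : Finset ℂ, R.card = a + 1 ∧ S.card = b + 1 ∧ (R ∩ S).card = a ⊓ b + 1 ∧
      HasMomentWeights c a R ∧ HasMomentWeights c b S := by
  rcases le_total a b with h | h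
  · obtain ⟨R, S, hRS, hR, hS, hRw, hSw⟩ := exists_nested_momentWeights (b := b) ha (by
      rw [abs_of_nonpos (by omega)] at hab
      omega)
    exact ⟨R, S, hR, hS, by rw [Finset.inter_eq_left.2 hRS, hR, inf_eq_left.2 h], hRw, hSw⟩
  · obtain ⟨S, R, hRS, hS, hR, hSw, hRw⟩ := exists_nested_momentWeights (b := a) hb (by
      rw [abs_of_nonneg (by omega)] at hab
      omega)
    exact ⟨R, S, hR, hS, by rw [Finset.inter_eq_right.2 hRS, hS, inf_eq_right.2 h], hRw, hSw⟩

/-! ### Upper bound from grids -/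

theorem specialMonomial_eq_sum_pow {n c : ℕ} {a : Fin n → ℕ} {R : Fin n → Finset ℂ}
    (hR : ∀ i, HasMomentWeights c (a i) (R i)) :
    ∃ w : (Fin n → ℂ) → ℂ, specialMonomial c a = ∑ z ∈ Fintype.piFinset R, MvPolynomial.C (w z) *
      (∑ i, (Fin.cons 1 z : Fin (n + 1) → ℂ) i • MvPolynomial.X i) ^
        (specialMonomial c a).totalDegree := by
  choose w hw using hR
  set M := (Finsupp.equivFunOnFinite.symm (Fin.cons c a : Fin (n + 1) → ℕ)).multinomial with hM
  refine ⟨fun z => (M : ℂ)⁻¹ * ∏ i, w i (z i), ?_⟩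
  rw [totalDegree_specialMonomial, specialMonomial_eq_monomial]
  ext m
  obtain ⟨f, rfl⟩ := Finsupp.equivFunOnFinite.symm.surjective m
  simp only [MvPolynomial.coeff_monomial, MvPolynomial.coeff_sum, MvPolynomial.coeff_C_mul,
    coeff_linearForm_pow, EmbeddingLike.apply_eq_iff_eq]
  by_cases hf : ∑ i, f i = c + ∑ i, a i
  · have hsum : ∑ z ∈ Fintype.piFinset R, ∏ i, w i (z i) * z i ^ f i.succ =
        ∏ i, ∑ x ∈ R i, w i x * x ^ f i.succ :=
      (Finset.prod_univ_sum R fun i x => w i x * x ^ f i.succ).symm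
    have hprod : ∏ i, ∑ x ∈ R i, w i x * x ^ f i.succ =
        if (Fin.cons c a : Fin (n + 1) → ℕ) = f then 1 else 0 := by
      split_ifs with h
      · subst h
        refine Finset.prod_eq_one fun i _ => ?_
        rw [Fin.cons_succ, hw i _ (Nat.le_add_right _ _), if_pos rfl]
      · rw [Finset.prod_eq_zero_iff]
        by_contra! hne
        have hge : ∀ i, a i ≤ f i.succ := by
          intro i
          by_contra hlt
          exact hne i (Finset.mem_univ i) (by rw [hw i _ (by omega), if_neg (by omega)])
        rw [Fin.sum_univ_succ] at hf
        -- With every `f i.succ ≥ a i`, the total degree leaves an excess of at most `c`, within the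
        -- range of the weights.
        have hle : ∀ i, f i.succ ≤ a i + c := by
          intro i
          have h1 : ∑ j : Fin n, f j.succ = f i.succ + ∑ j ∈ Finset.univ.erase i, f j.succ :=
            (Finset.add_sum_erase _ _ (Finset.mem_univ i)).symm
          have h2 : ∑ j, a j = a i + ∑ j ∈ Finset.univ.erase i, a j :=
            (Finset.add_sum_erase _ _ (Finset.mem_univ i)).symm
          have h3 : ∑ j ∈ Finset.univ.erase i, a j ≤ ∑ j ∈ Finset.univ.erase i, f j.succ :=
            Finset.sum_le_sum fun j _ => hge j
          omega
        have heq : ∀ i, a i = f i.succ := by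
          intro i
          by_contra hne'
          exact hne i (Finset.mem_univ i) (by rw [hw i _ (hle i), if_neg (Ne.symm hne')])
        refine h (funext fun i => Fin.cases ?_ (fun i => ?_) i)
        · have : ∑ i, a i = ∑ i : Fin n, f i.succ := Finset.sum_congr rfl fun i _ => heq i
          rw [Fin.cons_zero]
          omega
        · rw [Fin.cons_succ, heq]
    simp only [hf, if_true]
    have hterm : ∀ z : Fin n → ℂ, (M : ℂ)⁻¹ * (∏ i, w i (z i)) *
        (((Finsupp.equivFunOnFinite.symm f).multinomial : ℂ) *
          ∏ i, (Fin.cons 1 z : Fin (n + 1) → ℂ) i ^ f i) =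
        (M : ℂ)⁻¹ * ((Finsupp.equivFunOnFinite.symm f).multinomial : ℂ) *
          ∏ i, w i (z i) * z i ^ f i.succ := by
      intro z
      rw [Fin.prod_univ_succ, Finset.prod_mul_distrib]
      simp only [Fin.cons_zero, Fin.cons_succ, one_pow]
      ring
    simp_rw [hterm]
    rw [← Finset.mul_sum, hsum, hprod]
    split_ifs with h
    · subst h
      rw [mul_one, hM, inv_mul_cancel₀ (multinomial_cast_ne_zero _)]
    · rw [mul_zero]
  · simp only [hf, if_false, mul_zero, Finset.sum_const_zero]
    rw [if_neg]
    rintro rfl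
    simp [Fin.sum_univ_succ] at hf

/-- Several monomials are decomposed by the union of their grids of linear forms. -/
theorem hasSimultaneousWaringDecomposition_of_grids {n c : ℕ}
    {𝓕 : Set (MvPolynomial (Fin (n + 1)) ℂ)} {Z : Finset (Fin n → ℂ)}
    (h𝓕 : ∀ F ∈ 𝓕, ∃ (a : Fin n → ℕ) (R : Fin n → Finset ℂ), F = specialMonomial c a ∧
      Fintype.piFinset R ⊆ Z ∧ ∀ i, HasMomentWeights c (a i) (R i)) :
    HasSimultaneousWaringDecomposition 𝓕 Z.card := by
  classical
  refine ⟨fun j => ∑ i, (Fin.cons 1 (Z.equivFin.symm j).1 : Fin (n + 1) → ℂ) i •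
    MvPolynomial.X i, fun j => ?_, fun F hF => ?_⟩
  · refine MvPolynomial.IsHomogeneous.sum _ _ _ fun i _ => ?_
    rw [MvPolynomial.smul_eq_C_mul]
    exact MvPolynomial.isHomogeneous_C_mul_X _ _
  · obtain ⟨a, R, rfl, hRZ, hR⟩ := h𝓕 F hF
    obtain ⟨w, hw⟩ := specialMonomial_eq_sum_pow hR
    refine ⟨fun j => if (Z.equivFin.symm j).1 ∈ Fintype.piFinset R then
      w (Z.equivFin.symm j).1 else 0, ?_⟩
    rw [Z.equivFin.symm.sum_comp fun z : Z =>
      MvPolynomial.C (if z.1 ∈ Fintype.piFinset R then w z.1 else 0) *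
        (∑ i, (Fin.cons 1 z.1 : Fin (n + 1) → ℂ) i • MvPolynomial.X i) ^
          (specialMonomial c a).totalDegree,
      Finset.sum_coe_sort Z fun z : Fin n → ℂ =>
      MvPolynomial.C (if z ∈ Fintype.piFinset R then w z else 0) *
        (∑ i, (Fin.cons 1 z : Fin (n + 1) → ℂ) i • MvPolynomial.X i) ^
          (specialMonomial c a).totalDegree]
    rw [← Finset.sum_subset hRZ]
    · conv_lhs => rw [hw]
      exact Finset.sum_congr rfl fun z hz => by rw [if_pos hz]
    · intro z _ hz
      rw [if_neg hz, map_zero, zero_mul]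

/-! ### Exact ranks -/

theorem simultaneousWaringRank_eq_of_forall_le {n r : ℕ}
    {𝓕 : Set (MvPolynomial (Fin (n + 1)) ℂ)}
    (h : HasSimultaneousWaringDecomposition 𝓕 r)
    (hle : ∀ s, HasSimultaneousWaringDecomposition 𝓕 s → r ≤ s) :
    simultaneousWaringRank 𝓕 = r :=
  le_antisymm (iInf₂_le r h) (le_iInf₂ fun s hs => by exact_mod_cast hle s hs)

theorem card_Iic_pi {n : ℕ} (a : Fin n → ℕ) : (Finset.Iic a).card = ∏ i, (a i + 1) := by
  simp [Pi.card_Iic]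

theorem waringRank_specialMonomial {n c : ℕ} {a : Fin n → ℕ} (hc : 1 ≤ c) (ha : ∀ i, c ≤ a i) :
    waringRank (specialMonomial c a) = (∏ i, (a i + 1) : ℕ) := by
  choose R S _ hR _ hRw _ using fun i => exists_nested_momentWeights (ha i) (Or.inl rfl)
  have hcard : (Fintype.piFinset R).card = ∏ i, (a i + 1) := by simp [Fintype.card_piFinset, hR]
  refine simultaneousWaringRank_eq_of_forall_le ?_ fun s hs => ?_
  · rw [← hcard]
    refine hasSimultaneousWaringDecomposition_of_grids (c := c) fun F hF => ?_
    exact ⟨a, R, hF, subset_rfl, hRw⟩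
  · simpa [card_Iic_pi] using card_biUnion_Iic_le hc (A := {a}) (by simp) hs

theorem simultaneousWaringRank_pair_specialMonomial {n c : ℕ} {a b : Fin n → ℕ} (hc : 1 ≤ c)
    (ha : ∀ i, c ≤ a i) (hb : ∀ i, c ≤ b i)
    (hab : ∀ i, |(a i : ℤ) - (b i : ℤ)| = 0 ∨ |(a i : ℤ) - (b i : ℤ)| = 1 ∨
      (c : ℤ) + 1 ≤ |(a i : ℤ) - (b i : ℤ)|) :
    simultaneousWaringRank {specialMonomial c a, specialMonomial c b} =
      (Finset.Iic a ∪ Finset.Iic b).card := by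
  classical
  choose R S hR hS hRS hRw hSw using fun i => exists_momentWeights_pair (ha i) (hb i) (hab i)
  have hinter : Fintype.piFinset R ∩ Fintype.piFinset S = Fintype.piFinset fun i => R i ∩ S i := by
    ext z
    simp [forall_and]
  have hIic : Finset.Iic a ∩ Finset.Iic b = Finset.Iic (a ⊓ b) := by
    ext z
    simp
  have hcard : (Fintype.piFinset R ∪ Fintype.piFinset S).card =
      (Finset.Iic a ∪ Finset.Iic b).card := by
    rw [Finset.card_union, Finset.card_union, hinter, hIic]
    simp only [Fintype.card_piFinset, hR, hS, hRS, card_Iic_pi, Pi.inf_apply]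
  refine simultaneousWaringRank_eq_of_forall_le ?_ fun s hs => ?_
  · rw [← hcard]
    refine hasSimultaneousWaringDecomposition_of_grids (c := c) fun F hF => ?_
    rcases hF with hF | hF
    · exact ⟨a, R, hF, Finset.subset_union_left, hRw⟩
    · exact ⟨b, S, hF, Finset.subset_union_right, hSw⟩
  · simpa [Finset.biUnion_insert] using card_biUnion_Iic_le hc (A := {a, b}) (by simp) hs

/-! ### Scalar factors and the greatest common divisor -/

theorem hasSimultaneousWaringDecomposition_C_mul {n r : ℕ} {F : MvPolynomial (Fin (n + 1)) ℂ}
    {u : ℂ} (hu : u ≠ 0) (h : HasSimultaneousWaringDecomposition {F} r) :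
    HasSimultaneousWaringDecomposition {MvPolynomial.C u * F} r := by
  obtain ⟨L, hL, h⟩ := h
  obtain ⟨w, hw⟩ := h F rfl
  refine ⟨L, hL, ?_⟩
  rintro _ rfl
  have hdeg : (MvPolynomial.C u * F).totalDegree = F.totalDegree := by
    rw [MvPolynomial.totalDegree, MvPolynomial.totalDegree, ← MvPolynomial.smul_eq_C_mul,
      MvPolynomial.support_smul_eq hu]
  refine ⟨fun j => u * w j, ?_⟩
  rw [hdeg]
  conv_lhs => rw [hw, Finset.mul_sum]
  exact Finset.sum_congr rfl fun j _ => by rw [map_mul, mul_assoc]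

theorem waringRank_C_mul {n : ℕ} (F : MvPolynomial (Fin (n + 1)) ℂ) {u : ℂ} (hu : u ≠ 0) :
    waringRank (MvPolynomial.C u * F) = waringRank F := by
  have h : ∀ r, HasSimultaneousWaringDecomposition {MvPolynomial.C u * F} r ↔
      HasSimultaneousWaringDecomposition {F} r := by
    refine fun r => ⟨fun h => ?_, hasSimultaneousWaringDecomposition_C_mul hu⟩
    have := hasSimultaneousWaringDecomposition_C_mul (inv_ne_zero hu) h
    rwa [← mul_assoc, ← map_mul, inv_mul_cancel₀ hu, map_one, one_mul] at this
  simp only [waringRank, simultaneousWaringRank, h]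

theorem exists_eq_C_mul_of_isGreatestCommonDivisor {n c : ℕ} {a b : Fin n → ℕ}
    {D : MvPolynomial (Fin (n + 1)) ℂ}
    (hD : IsGreatestCommonDivisor (specialMonomial c a) (specialMonomial c b) D) :
    ∃ u : ℂ, u ≠ 0 ∧ D = MvPolynomial.C u * specialMonomial c (a ⊓ b) := by
  obtain ⟨h1, h2, h3⟩ := hD
  have hdvd : ∀ e f : Fin n → ℕ, e ≤ f → specialMonomial c e ∣ specialMonomial c f :=
    fun e f hef => mul_dvd_mul_left _
      (Finset.prod_dvd_prod_of_dvd _ _ fun i _ => pow_dvd_pow _ (hef i))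
  have h4 := h3 _ (hdvd _ a inf_le_left) (hdvd _ b inf_le_right)
  rw [specialMonomial_eq_monomial] at h1 h2 h4
  obtain ⟨m, u, hma, hu, rfl⟩ := (MvPolynomial.dvd_monomial_iff_exists one_ne_zero).1 h1
  have hu0 : u ≠ 0 := by
    rintro rfl
    simp at hu
  have hmb := (MvPolynomial.monomial_dvd_monomial.1 h2).1.resolve_left one_ne_zero
  have hle := (MvPolynomial.monomial_dvd_monomial.1 h4).1.resolve_left hu0
  refine ⟨u, hu0, ?_⟩
  rw [specialMonomial_eq_monomial, MvPolynomial.C_mul_monomial, mul_one]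
  congr 2
  refine le_antisymm (fun i => Fin.cases ?_ (fun i => ?_) i) hle
  · exact hma 0
  · exact le_inf (hma i.succ) (hmb i.succ)

theorem mainTheorem1 (n c : ℕ) (a b : Fin n → ℕ) (hc : 1 ≤ c)
    (ha : ∀ i, c ≤ a i) (hb : ∀ i, c ≤ b i)
    (hab : ∀ i, |(a i : ℤ) - (b i : ℤ)| = 0 ∨ |(a i : ℤ) - (b i : ℤ)| = 1 ∨
      (c : ℤ) + 1 ≤ |(a i : ℤ) - (b i : ℤ)|)
    (M₁ M₂ M₁₂ : MvPolynomial (Fin (n + 1)) ℂ)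
    (hM₁ : M₁ = specialMonomial c a) (hM₂ : M₂ = specialMonomial c b)
    (hM₁₂ : IsGreatestCommonDivisor M₁ M₂ M₁₂) :
    ∃ r r₁ r₂ r₁₂ : ℕ,
      simultaneousWaringRank {M₁, M₂} = r ∧ waringRank M₁ = r₁ ∧ waringRank M₂ = r₂ ∧
        waringRank M₁₂ = r₁₂ ∧ (r : ℤ) = (r₁ : ℤ) + (r₂ : ℤ) - (r₁₂ : ℤ) := by
  subst hM₁ hM₂
  obtain ⟨u, hu, rfl⟩ := exists_eq_C_mul_of_isGreatestCommonDivisor hM₁₂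
  refine ⟨_, _, _, _, simultaneousWaringRank_pair_specialMonomial hc ha hb hab,
    waringRank_specialMonomial hc ha, waringRank_specialMonomial hc hb,
    (waringRank_C_mul _ hu).trans
      (waringRank_specialMonomial hc fun i => le_inf (ha i) (hb i)), ?_⟩
  have hIic : Finset.Iic a ∩ Finset.Iic b = Finset.Iic (a ⊓ b) := by
    ext z
    simp
  have := Finset.card_union_add_card_inter (Finset.Iic a) (Finset.Iic b)
  rw [hIic, card_Iic_pi, card_Iic_pi, card_Iic_pi] at this
  omega
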